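/- Let $0<s<r<1$ and, for every $n\ge 1$, let $\mathcal H_{1}\subseteq\{1,\dots,n\}$ be a set of $m=n^{1-s}$ signals, where $m$ is $n^{1-s}$ rounded to an integer (up or down), and let $\mathcal H_0$ be its complement. In the iid Gaussian location model with shift $\mu=\sqrt{2r\log n}$ the observations are $X_i=W_i$ for $i\in\mathcal H_0$ and $X_i=W_i+\mu$ for $i\in\mathcal H_1$, with $W_1,\dots,W_n$ iid standard normal. A top-$K$ procedure chooses a number $K\in\{0,\dots,n\}$ as a (possibly randomized) measurable function of $X=(X_1,\dots,X_n)$ and rejects $\mathcal I=\{i : X_i\ge \text{the } K\text{-th largest of } X_1,\dots,X_n\}$ (with $\mathcal I=\emptyset$ if $K=0$). Put $$\mathrm{FDR}=\mathbb E\Big[\frac{|\mathcal I\cap\mathcal H_0|}{\max(|\mathcal I|,1)}\Big],\qquad \mathrm{FNR}=\mathbb E\Big[\frac{|\mathcal I^{c}\cap\mathcal H_1|}{|\mathcal H_1|}\Big].$$ Let $\kappa_\alpha,\kappa_\beta\in\mathbb R$ and $c>0$ be constants, and put $\alpha_n=cn^{-\kappa_\alpha}$ and $\beta_n=cn^{-\kappa_\beta}$.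 Suppose that $\alpha_n<1$ and $\beta_n<1$ for all sufficiently large $n$ (equivalently, each of $\kappa_\alpha,\kappa_\beta$ is positive, or is zero with $c<1$), and that for all $n\ge1$ there is a top-$K$ procedure with $\mathrm{FDR}\le\alpha_n$ and $\mathrm{FNR}\le\beta_n$. Then $$\sqrt{s+\kappa_\alpha}+\sqrt{\kappa_\beta}\le\sqrt r\qquad\text{and}\qquad \min\{\kappa_\alpha,\kappa_\beta\}\le\frac{(r-s)^2}{4r}.$$ -/

import Mathlib

open MeasureTheory ProbabilityTheory

noncomputable section

namespace MultipleTesting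

/-- The order statistics of `x` in decreasing order: `descOrderStat x j` is the `(j+1)`-st
largest of `x 0, …, x (n-1)`, counted with multiplicity. -/
def descOrderStat {n : ℕ} (x : Fin n → ℝ) (j : Fin n) : ℝ :=
  x (Tuple.sort x (Fin.rev j))

/-- The discoveries made when the top `k` order statistics are rejected: all `i` for which `x i`
is at least the `k`-th largest observation, and no `i` if `k = 0`. -/
def topSet {n : ℕ} (x : Fin n → ℝ) (k : Fin (n + 1)) : Finset (Fin n) :=
  open Classical in
  Finset.univ.filter fun i => ∃ j : Fin n, (j : ℕ) + 1 = (k : ℕ) ∧ descOrderStat x j ≤ x i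

/-- False discovery proportion of the set `I` of discoveries, when `H` is the set of signals. -/
def fdp {n : ℕ} (H I : Finset (Fin n)) : ℝ :=
  ((I \ H).card : ℝ) / (max I.card 1 : ℕ)

/-- False non-discovery proportion of the set `I` of discoveries, when `H` is the set of
signals. -/
def fnp {n : ℕ} (H I : Finset (Fin n)) : ℝ :=
  ((H \ I).card : ℝ) / (H.card : ℝ)

/-- The test statistics built from the underlying vector `w`: `w i` for a null `i`, and `f (w i)`
for a signal `i ∈ H`. -/
def observe {n : ℕ} (H : Finset (Fin n)) (f : ℝ → ℝ) (w : Fin n → ℝ) : Fin n → ℝ :=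
  fun i => if i ∈ H then f (w i) else w i

/-- The law of the vector of test statistics in the iid Gaussian location model with signal set
`H` and shift `μ`: the underlying variables are iid standard normal and `f w = w + μ`. -/
def gaussianLocation {n : ℕ} (H : Finset (Fin n)) (μ : ℝ) : Measure (Fin n → ℝ) :=
  (Measure.pi fun _ : Fin n => gaussianReal 0 1).map (observe H fun w => w + μ)

/-- False discovery rate, when the statistics have law `P`, of the top-K procedure `K`.
A (possibly randomized) top-K procedure is a Markov kernel `K` from observations to `{0, …, n}`:
given the observations `x`, the number `k` of order statistics to reject has law `K x`. -/
def fdr {n : ℕ} (P : Measure (Fin n → ℝ)) (H : Finset (Fin n))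
    (K : Kernel (Fin n → ℝ) (Fin (n + 1))) : ℝ :=
  ∫ p, fdp H (topSet p.1 p.2) ∂(P.compProd K)

/-- False non-discovery rate, when the statistics have law `P`, of the top-K procedure `K`. -/
def fnr {n : ℕ} (P : Measure (Fin n → ℝ)) (H : Finset (Fin n))
    (K : Kernel (Fin n → ℝ) (Fin (n + 1))) : ℝ :=
  ∫ p, fnp H (topSet p.1 p.2) ∂(P.compProd K)

/-- There is an `(α, β)`-controlled top-K procedure. -/
def Achievable {n : ℕ} (P : Measure (Fin n → ℝ)) (H : Finset (Fin n)) (α β : ℝ) : Prop :=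
  ∃ K : Kernel (Fin n → ℝ) (Fin (n + 1)), IsMarkovKernel K ∧ fdr P H K ≤ α ∧ fnr P H K ≤ β

end MultipleTesting

end

/-!
The false non-discovery and false discovery proportions are compared at one deterministic threshold
`t = a √(2 log n)`. A rejection set of a top-K procedure is an upper level set of the observations,
so it either contains everything at or above `t`, in particular all nulls there, or contains nothing
at or below `t`, in particular misses all signals there (`topSet_dichotomy`). Hence, however the
number of rejections depends on the data, for every realization with at least `A` nulls above `t`
and at least a fraction `B` of the `m` signals below `t`,
`1 ≤ (1 + m / A) · FDP + FNP / B` (`one_le_fdp_add_fnp`).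

By Chebyshev's inequality both counts are at least `1 - δ` times their means with probability close
to one, as soon as the means diverge. Integrating gives a bound in terms of the two error rates
(`one_le_of_achievable`), which uses that all statistics of the rejection set are measurable. The
means are controlled by the Gaussian tail: at `b √(2 log n)` it is at least `n ^ (-(b² + ε))`
(`eventually_rpow_le_tail`). So about `n ^ (1 - a²)` nulls exceed `t`; for `a < √r` a
fraction `n ^ (-(√r - a)²)` of the signals falls below it, and for `a > √r` almost all of them.

If `√(s + κα) + √κβ > √r`, there is an `a` with `a² < s + κα` that also satisfies `√r - a < √κβ`,
and because `r < 1` it can be taken so that both means diverge. In the limit the bound reads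
`1 ≤ α₀ + β₀` for the limits `α₀`, `β₀` of the two levels (`one_le_add_of_tendsto`). At most one of
them is nonzero, and that one equals `c < 1`, a contradiction. The bound on `min κα κβ` follows
because the curve `√(s + κα) + √κβ = √r` meets the diagonal at `(r - s)² / (4 r)`.
-/

namespace MultipleTesting

/-! ### Top-K rejection sets -/

lemma mem_topSet {n : ℕ} {x : Fin n → ℝ} {k : Fin (n + 1)} {i : Fin n} :
    i ∈ topSet x k ↔ ∃ j : Fin n, (j : ℕ) + 1 = (k : ℕ) ∧ descOrderStat x j ≤ x i := by
  simp [topSet]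

/-- A rejection set is an upper level set of the observations, so it is comparable with any fixed
threshold `t`: it contains every index at or above `t`, or no index at or below `t`. -/
lemma topSet_dichotomy {n : ℕ} (x : Fin n → ℝ) (k : Fin (n + 1)) (t : ℝ) :
    (∀ i, t ≤ x i → i ∈ topSet x k) ∨ (∀ i, x i ≤ t → i ∉ topSet x k) := by
  by_cases h : ∃ j : Fin n, (j : ℕ) + 1 = (k : ℕ) ∧ descOrderStat x j ≤ t
  · obtain ⟨j, hj, hjt⟩ := h
    exact Or.inl fun i hi => mem_topSet.2 ⟨j, hj, hjt.trans hi⟩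
  · refine Or.inr fun i hi hmem => h ?_
    obtain ⟨j, hj, hji⟩ := mem_topSet.1 hmem
    exact ⟨j, hj, hji.trans hi⟩

lemma measurableSet_descOrderStat_le {n : ℕ} (i j : Fin n) :
    MeasurableSet {x : Fin n → ℝ | descOrderStat x j ≤ x i} := by
  have key : {x : Fin n → ℝ | descOrderStat x j ≤ x i} = ⋃ σ : Equiv.Perm (Fin n),
      {x | σ = Tuple.sort x} ∩ {x | x (σ (Fin.rev j)) ≤ x i} := by
    ext x
    simp [descOrderStat]
  rw [key]
  refine MeasurableSet.iUnion fun σ => MeasurableSet.inter ?_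
    (measurableSet_le (measurable_pi_apply _) (measurable_pi_apply _))
  have hσ : {x : Fin n → ℝ | σ = Tuple.sort x} =
      (⋂ a : Fin n, ⋂ b : Fin n, ⋂ _ : a ≤ b, {x | x (σ a) ≤ x (σ b)}) ∩
      ⋂ a : Fin n, ⋂ b : Fin n, ⋂ _ : a < b, ⋂ _ : ¬ σ a < σ b, {x | x (σ a) = x (σ b)}ᶜ := by
    ext x
    simp only [Set.mem_ofPred_eq, Tuple.eq_sort_iff, Set.mem_inter_iff, Set.mem_iInter,
      Set.mem_compl_iff]
    refine and_congr ⟨fun h a b hab => h hab, fun h a b hab => h a b hab⟩ ?_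
    exact forall_congr' fun a => forall_congr' fun b => forall_congr' fun _ => by tauto
  rw [hσ]
  refine MeasurableSet.inter ?_ ?_
  · exact MeasurableSet.iInter fun a => MeasurableSet.iInter fun b => MeasurableSet.iInter fun _ =>
      measurableSet_le (measurable_pi_apply _) (measurable_pi_apply _)
  · exact MeasurableSet.iInter fun a => MeasurableSet.iInter fun b => MeasurableSet.iInter fun _ =>
      MeasurableSet.iInter fun _ =>
        (measurableSet_eq_fun (measurable_pi_apply (σ a)) (measurable_pi_apply (σ b))).compl

lemma measurableSet_mem_topSet {n : ℕ} (k : Fin (n + 1)) (i : Fin n) :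
    MeasurableSet {x : Fin n → ℝ | i ∈ topSet x k} := by
  have : {x : Fin n → ℝ | i ∈ topSet x k} =
      ⋃ j : Fin n, ⋃ _ : (j : ℕ) + 1 = (k : ℕ), {x | descOrderStat x j ≤ x i} := by
    ext x
    simp [mem_topSet]
  rw [this]
  exact MeasurableSet.iUnion fun j => MeasurableSet.iUnion fun _ =>
    measurableSet_descOrderStat_le i j

/-- Any statistic of the rejection set is jointly measurable in the observations and `k`. -/
lemma measurable_comp_topSet {n : ℕ} (g : Finset (Fin n) → ℝ) :
    Measurable fun p : (Fin n → ℝ) × Fin (n + 1) => g (topSet p.1 p.2) := by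
  refine measurable_from_prod_countable_left fun k => ?_
  let _ : MeasurableSpace (Finset (Fin n)) := ⊤
  have hg : Measurable g := measurable_from_top
  refine hg.comp (measurable_to_countable' fun I => ?_)
  have : (fun x : Fin n → ℝ => topSet x k) ⁻¹' {I} =
      (⋂ i : Fin n, ⋂ _ : i ∈ I, {x | i ∈ topSet x k}) ∩
      ⋂ i : Fin n, ⋂ _ : i ∉ I, {x | i ∈ topSet x k}ᶜ := by
    ext x
    simp only [Set.mem_preimage, Set.mem_singleton_iff, Finset.ext_iff, Set.mem_inter_iff,
      Set.mem_iInter, Set.mem_ofPred_eq, Set.mem_compl_iff]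
    exact ⟨fun h => ⟨fun i hi => (h i).2 hi, fun i hi hx => hi ((h i).1 hx)⟩,
      fun h i => ⟨fun hx => by_contra fun hi => h.2 i hi hx, h.1 i⟩⟩
  rw [this]
  exact (MeasurableSet.iInter fun i => MeasurableSet.iInter fun _ =>
    measurableSet_mem_topSet k i).inter
    (MeasurableSet.iInter fun i => MeasurableSet.iInter fun _ =>
      (measurableSet_mem_topSet k i).compl)

/-- The integrands of `fdr` and `fnr` are integrable, so these are genuine expectations. Boundedness is
automatic, since there are only finitely many rejection sets. -/
lemma integrable_comp_topSet {n : ℕ} (g : Finset (Fin n) → ℝ)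
    (Q : Measure ((Fin n → ℝ) × Fin (n + 1))) [IsFiniteMeasure Q] :
    Integrable (fun p => g (topSet p.1 p.2)) Q := by
  refine Integrable.of_bound (measurable_comp_topSet g).aestronglyMeasurable
    (∑ I, |g I|) (Filter.Eventually.of_forall fun p => ?_)
  rw [Real.norm_eq_abs]
  exact Finset.single_le_sum (f := fun I => |g I|) (fun _ _ => abs_nonneg _) (Finset.mem_univ _)

lemma fdp_nonneg {n : ℕ} (H I : Finset (Fin n)) : 0 ≤ fdp H I := by
  unfold fdp; positivity

lemma fnp_nonneg {n : ℕ} (H I : Finset (Fin n)) : 0 ≤ fnp H I := by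
  unfold fnp; positivity

/-- The deterministic trade-off: if at least `A` nulls lie at or above `t` and at least a fraction
`B` of the signals lies at or below `t`, every rejection set makes at least one of the two false
proportions large. -/
lemma one_le_fdp_add_fnp {n : ℕ} {H : Finset (Fin n)} (hm : 0 < H.card) {x : Fin n → ℝ} {t A B : ℝ}
    (hA : 0 < A) (hB : 0 < B) (k : Fin (n + 1))
    (hN : A ≤ ((Hᶜ.filter fun i => t ≤ x i).card : ℝ))
    (hS : B * H.card ≤ ((H.filter fun i => x i ≤ t).card : ℝ)) :
    1 ≤ (1 + H.card / A) * fdp H (topSet x k) + fnp H (topSet x k) / B := by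
  have hm' : (0 : ℝ) < H.card := by exact_mod_cast hm
  have hd := fdp_nonneg H (topSet x k)
  have hn := fnp_nonneg H (topSet x k)
  rcases topSet_dichotomy x k t with h | h
  · have hsub : (Hᶜ.filter fun i => t ≤ x i) ⊆ topSet x k \ H := fun i hi => by
      simp only [Finset.mem_filter, Finset.mem_compl] at hi
      exact Finset.mem_sdiff.2 ⟨h i hi.2, hi.1⟩
    have hF : A ≤ ((topSet x k \ H).card : ℝ) :=
      hN.trans (by exact_mod_cast Finset.card_le_card hsub)
    have hF0 : 0 < (topSet x k \ H).card := by exact_mod_cast hA.trans_le hF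
    have hmax : max (topSet x k).card 1 ≤ (topSet x k \ H).card + H.card := by
      refine max_le ?_ (by omega)
      rw [← Finset.card_sdiff_add_card_inter (topSet x k) H]
      exact Nat.add_le_add_left (Finset.card_le_card Finset.inter_subset_right) _
    have hmax' : ((max (topSet x k).card 1 : ℕ) : ℝ) ≤ (topSet x k \ H).card + H.card := by
      exact_mod_cast hmax
    have hpos : (0 : ℝ) < (max (topSet x k).card 1 : ℕ) := by positivity
    have h1 : 1 ≤ (1 + H.card / A) * fdp H (topSet x k) := by
      unfold fdp
      rw [← mul_div_assoc, le_div_iff₀ hpos, one_mul, add_mul, one_mul, div_mul_eq_mul_div]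
      refine hmax'.trans (add_le_add_right ?_ _)
      rw [le_div_iff₀ hA]
      exact mul_le_mul_of_nonneg_left hF hm'.le
    exact h1.trans (le_add_of_nonneg_right (div_nonneg hn hB.le))
  · have hsub : (H.filter fun i => x i ≤ t) ⊆ H \ topSet x k := fun i hi => by
      simp only [Finset.mem_filter] at hi
      exact Finset.mem_sdiff.2 ⟨hi.1, h i hi.2⟩
    have hF : B * H.card ≤ ((H \ topSet x k).card : ℝ) :=
      hS.trans (by exact_mod_cast Finset.card_le_card hsub)
    have h1 : 1 ≤ fnp H (topSet x k) / B := by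
      rw [le_div_iff₀ hB, one_mul, fnp, le_div_iff₀ hm']
      exact hF
    exact h1.trans (le_add_of_nonneg_left (by positivity))

/-! ### Concentration of counts -/

/-- Chebyshev's inequality for the number of coordinates in `S` that fall into `E`; the variance is
at most the mean `|S| ν(E)`. -/
lemma measureReal_count_le {n : ℕ} (ν : Measure ℝ) [IsProbabilityMeasure ν] (S : Finset (Fin n))
    {E : Set ℝ} (hE : MeasurableSet E) [DecidablePred (· ∈ E)] {δ : ℝ} (hδ : 0 < δ)
    (hpos : 0 < S.card * ν.real E) :
    (Measure.pi fun _ : Fin n => ν).real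
        {w | ((S.filter fun i => w i ∈ E).card : ℝ) < (1 - δ) * (S.card * ν.real E)} ≤
      1 / (δ ^ 2 * (S.card * ν.real E)) := by
  set P := Measure.pi fun _ : Fin n => ν
  set M := S.card * ν.real E with hM
  set g : ℝ → ℝ := E.indicator 1 with hg
  have hgm : Measurable g := measurable_one.indicator hE
  set X : Fin n → (Fin n → ℝ) → ℝ := fun i w => g (w i) with hX
  have hXm : ∀ i, Measurable (X i) := fun i => hgm.comp (measurable_pi_apply i)
  have hbd : ∀ y, ‖g y‖ ≤ 1 := fun y => by
    by_cases hy : y ∈ E <;> simp [hg, hy]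
  have hL2 : ∀ i, MemLp (X i) 2 P := fun i =>
    MemLp.of_bound (hXm i).aestronglyMeasurable 1 (Filter.Eventually.of_forall fun w => hbd _)
  have hint : ∀ i, ∫ w, X i w ∂P = ν.real E := fun i => by
    have := integral_comp_eval (μ := fun _ : Fin n => ν) (i := i) (f := g)
      hgm.aestronglyMeasurable
    simp only [hX]
    rw [this, hg, integral_indicator_one hE]
  have hvar : ∀ i, Var[X i; P] ≤ ν.real E := fun i => by
    refine (variance_le_expectation_sq (hXm i).aestronglyMeasurable).trans (le_of_eq ?_)
    rw [← hint i]
    congr 1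
    ext w
    by_cases hy : w i ∈ E <;> simp [hX, hg, hy]
  have hind : iIndepFun X P := iIndepFun_pi (μ := fun _ : Fin n => ν) (X := fun _ => g)
    fun i => hgm.aemeasurable
  have hsumvar : Var[∑ i ∈ S, X i; P] ≤ M := by
    rw [IndepFun.variance_sum (fun i _ => hL2 i) fun i _ j _ hij => hind.indepFun hij]
    refine (Finset.sum_le_sum fun i _ => hvar i).trans (le_of_eq ?_)
    simp [hM]
  have hsumint : ∫ w, (∑ i ∈ S, X i) w ∂P = M := by
    simp only [Finset.sum_apply]
    rw [integral_finsetSum _ fun i _ => (hL2 i).integrable one_le_two]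
    simp [hint, hM]
  have hcount : ∀ w, ((S.filter fun i => w i ∈ E).card : ℝ) = (∑ i ∈ S, X i) w := fun w => by
    simp [hX, hg, Set.indicator_apply, Finset.sum_apply]
  have hcheb := meas_ge_le_variance_div_sq (memLp_finsetSum' S fun i _ => hL2 i)
    (mul_pos hδ hpos)
  rw [hsumint] at hcheb
  have hsub : {w : Fin n → ℝ | ((S.filter fun i => w i ∈ E).card : ℝ) < (1 - δ) * M} ⊆
      {w | δ * M ≤ |(∑ i ∈ S, X i) w - M|} := fun w hw => by
    simp only [Set.mem_ofPred_eq, hcount] at hw ⊢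
    rw [abs_sub_comm]
    exact le_trans (by linarith) (le_abs_self _)
  have h1 : P.real {w | ((S.filter fun i => w i ∈ E).card : ℝ) < (1 - δ) * M} ≤
      Var[∑ i ∈ S, X i; P] / (δ * M) ^ 2 :=
    ENNReal.toReal_le_of_le_ofReal (div_nonneg (variance_nonneg _ _) (sq_nonneg _))
      ((measure_mono hsub).trans hcheb)
  refine h1.trans ?_
  rw [div_le_div_iff₀ (by positivity) (by positivity)]
  have : 0 ≤ δ ^ 2 * M := by positivity
  nlinarith [mul_le_mul_of_nonneg_left hsumvar this]

/-! ### A non-asymptotic lower bound -/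

lemma measurable_observe {n : ℕ} (H : Finset (Fin n)) {f : ℝ → ℝ} (hf : Measurable f) :
    Measurable (observe H f) := by
  refine measurable_pi_lambda _ fun i => ?_
  by_cases hi : i ∈ H
  · simp only [observe, hi, if_true]
    exact hf.comp (measurable_pi_apply i)
  · simpa [observe, hi] using measurable_pi_apply i

instance {n : ℕ} (H : Finset (Fin n)) (μ : ℝ) : IsProbabilityMeasure (gaussianLocation H μ) :=
  Measure.isProbabilityMeasure_map (measurable_observe H (measurable_add_const μ)).aemeasurable

/-- Integrating the deterministic trade-off: the deviation from `1` is the probability that one of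
the two counts falls below `1 - δ` times its mean. -/
lemma one_le_of_achievable {n : ℕ} {H : Finset (Fin n)} {μ α β : ℝ}
    (hach : Achievable (gaussianLocation H μ) H α β) (t : ℝ) {δ p q : ℝ} (hδ : 0 < δ) (hδ1 : δ < 1)
    (hp : p = (gaussianReal 0 1).real (Set.Ici t))
    (hq : q = (gaussianReal 0 1).real (Set.Iic (t - μ)))
    (hN : 0 < Hᶜ.card * p) (hS : 0 < H.card * q) :
    1 ≤ (1 + H.card / ((1 - δ) * (Hᶜ.card * p))) * α + β / ((1 - δ) * q) +
      1 / (δ ^ 2 * (Hᶜ.card * p)) + 1 / (δ ^ 2 * (H.card * q)) := by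
  classical
  obtain ⟨K, hK, hα, hβ⟩ := hach
  set P := gaussianLocation H μ with hP
  set A := (1 - δ) * (Hᶜ.card * p) with hA
  set B := (1 - δ) * q with hB
  have hm : 0 < H.card := Nat.pos_of_ne_zero fun h => by simp [h] at hS
  have hq0 : 0 < q := pos_of_mul_pos_right hS (Nat.cast_nonneg _)
  have hA0 : 0 < A := mul_pos (by linarith) hN
  have hB0 : 0 < B := mul_pos (by linarith) hq0
  set G : Set (Fin n → ℝ) := {x | A ≤ ((Hᶜ.filter fun i => t ≤ x i).card : ℝ) ∧
    B * H.card ≤ ((H.filter fun i => x i ≤ t).card : ℝ)} with hG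
  have hmeas_count : ∀ (S : Finset (Fin n)) (E : Set ℝ), MeasurableSet E →
      Measurable fun x : Fin n → ℝ => ((S.filter fun i => x i ∈ E).card : ℝ) := by
    intro S E hE
    have : (fun x : Fin n → ℝ => ((S.filter fun i => x i ∈ E).card : ℝ)) =
        fun x => ∑ i ∈ S, E.indicator 1 (x i) := by
      ext x
      simp [Set.indicator_apply]
    rw [this]
    exact Finset.measurable_sum _ fun i _ =>
      (measurable_one.indicator hE).comp (measurable_pi_apply i)
  have hGm : MeasurableSet G :=
    (measurableSet_le measurable_const (hmeas_count Hᶜ (Set.Ici t) measurableSet_Ici)).inter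
      (measurableSet_le measurable_const (hmeas_count H (Set.Iic t) measurableSet_Iic))
  -- In terms of the noise, the bad event is that one of two binomial counts is small.
  have hbad : P.real Gᶜ ≤ 1 / (δ ^ 2 * (Hᶜ.card * p)) + 1 / (δ ^ 2 * (H.card * q)) := by
    rw [hP, gaussianLocation, map_measureReal_apply
      (measurable_observe H (measurable_add_const μ)) hGm.compl]
    have hsub : observe H (fun w => w + μ) ⁻¹' Gᶜ ⊆
        {w | ((Hᶜ.filter fun i => w i ∈ Set.Ici t).card : ℝ) < (1 - δ) * (Hᶜ.card * p)} ∪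
        {w | ((H.filter fun i => w i ∈ Set.Iic (t - μ)).card : ℝ) <
          (1 - δ) * (H.card * q)} := by
      intro w hw
      have e1 : (Hᶜ.filter fun i => t ≤ observe H (fun w => w + μ) w i) =
          Hᶜ.filter fun i => w i ∈ Set.Ici t := by
        refine Finset.filter_congr fun i hi => ?_
        simp [observe, Finset.mem_compl.1 hi]
      have e2 : (H.filter fun i => observe H (fun w => w + μ) w i ≤ t) =
          H.filter fun i => w i ∈ Set.Iic (t - μ) := by
        refine Finset.filter_congr fun i hi => ?_
        simp [observe, hi, le_sub_iff_add_le]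
      simp only [hG, Set.mem_preimage, Set.mem_compl_iff, Set.mem_ofPred_eq, e1, e2,
        not_and_or, not_le] at hw
      refine hw.imp id fun h => h.trans_eq ?_
      rw [hB]; ring
    refine (measureReal_mono hsub).trans ((measureReal_union_le _ _).trans (add_le_add ?_ ?_))
    · have := measureReal_count_le (gaussianReal 0 1) Hᶜ (E := Set.Ici t) measurableSet_Ici hδ
        (by rwa [← hp])
      rwa [← hp] at this
    · have := measureReal_count_le (gaussianReal 0 1) H (E := Set.Iic (t - μ)) measurableSet_Iic hδ
        (by rwa [← hq])
      rwa [← hq] at this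
  have hgood : P.real G ≤ (1 + H.card / A) * fdr P H K + fnr P H K / B := by
    have hfst : P.real G = (P ⊗ₘ K).real (Prod.fst ⁻¹' G) := by
      rw [← map_measureReal_apply measurable_fst hGm]
      exact congrArg (fun Q : Measure (Fin n → ℝ) => Q.real G) (Measure.fst_compProd P K).symm
    have hd := (integrable_comp_topSet (fdp H) (P ⊗ₘ K)).const_mul (1 + H.card / A)
    have hn := (integrable_comp_topSet (fnp H) (P ⊗ₘ K)).div_const B
    rw [hfst, fdr, fnr, ← integral_const_mul, ← integral_div, ← integral_add hd hn,
      ← integral_indicator_one (measurable_fst hGm)]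
    refine integral_mono ((integrable_const (1 : ℝ)).indicator (measurable_fst hGm))
      (hd.add hn) fun z => ?_
    by_cases hz : z ∈ Prod.fst ⁻¹' G
    · simp only [Set.indicator_of_mem hz]
      exact one_le_fdp_add_fnp hm hA0 hB0 z.2 hz.1 hz.2
    · simp only [Set.indicator_of_notMem hz]
      have := fdp_nonneg H (topSet z.1 z.2)
      have := fnp_nonneg H (topSet z.1 z.2)
      positivity
  have hcompl : P.real G + P.real Gᶜ = 1 := by
    rw [measureReal_add_measureReal_compl hGm]; simp
  have h1 : (1 + H.card / A) * fdr P H K ≤ (1 + H.card / A) * α :=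
    mul_le_mul_of_nonneg_left hα (by positivity)
  have h2 : fnr P H K / B ≤ β / B := div_le_div_of_nonneg_right hβ hB0.le
  linarith

/-! ### Gaussian tails -/

lemma gaussianPDFReal_le_measureReal_Ici {x : ℝ} (hx : 0 ≤ x) :
    gaussianPDFReal 0 1 (x + 1) ≤ (gaussianReal 0 1).real (Set.Ici x) := by
  have h1 : gaussianPDFReal 0 1 (x + 1) ≤ ∫ y in Set.Icc x (x + 1), gaussianPDFReal 0 1 y := by
    have hc : ∫ y in Set.Icc x (x + 1), gaussianPDFReal 0 1 (x + 1) =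
        gaussianPDFReal 0 1 (x + 1) := by simp
    rw [← hc]
    refine setIntegral_mono_on (by simp) (integrable_gaussianPDFReal 0 1).integrableOn
      measurableSet_Icc fun y hy => ?_
    simp only [gaussianPDFReal, sub_zero]
    have : y ^ 2 ≤ (x + 1) ^ 2 := pow_le_pow_left₀ (hx.trans hy.1) hy.2 2
    gcongr
  refine h1.trans ?_
  rw [Measure.real, gaussianReal_apply_eq_integral 0 one_ne_zero, ENNReal.toReal_ofReal
    (integral_nonneg fun y => gaussianPDFReal_nonneg 0 1 y)]
  exact setIntegral_mono_set (integrable_gaussianPDFReal 0 1).integrableOn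
    (Filter.Eventually.of_forall fun y => gaussianPDFReal_nonneg 0 1 y)
    (Filter.Eventually.of_forall fun y hy => hy.1)

lemma measureReal_Iic_neg (x : ℝ) :
    (gaussianReal 0 1).real (Set.Iic (-x)) = (gaussianReal 0 1).real (Set.Ici x) := by
  have h : (gaussianReal 0 1).map (fun y => -y) = gaussianReal 0 1 := by
    rw [gaussianReal_map_neg, neg_zero]
  conv_lhs => rw [← h]
  rw [map_measureReal_apply measurable_neg measurableSet_Iic]
  congr 1
  ext y
  simp

/-- On the scale `√(2 log n)` the upper tail at `a` is `n ^ (-a²)` up to a subpolynomial factor;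
only the lower bound is needed. -/
lemma eventually_rpow_le_tail {a ε : ℝ} (ha : 0 ≤ a) (hε : 0 < ε) :
    ∀ᶠ n : ℕ in Filter.atTop, (n : ℝ) ^ (-(a ^ 2 + ε)) ≤
      (gaussianReal 0 1).real (Set.Ici (a * √(2 * Real.log n))) := by
  have hL : Filter.Tendsto (fun n : ℕ => √(2 * Real.log n)) Filter.atTop Filter.atTop :=
    Real.tendsto_sqrt_atTop.comp ((Real.tendsto_log_atTop.comp
      tendsto_natCast_atTop_atTop).const_mul_atTop two_pos)
  set C : ℝ := 1 / 2 + Real.log (√(2 * Real.pi)) with hC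
  -- The exponents compare as `(a L + 1)² / 2 + log √(2π) ≤ (a² + ε) L² / 2` once `L` is large.
  filter_upwards [hL.eventually_ge_atTop (4 * a / ε), hL.eventually_ge_atTop (4 * |C| / ε),
    hL.eventually_ge_atTop 1, Filter.eventually_ge_atTop 1] with n h1 h2 h3 hn
  set L := √(2 * Real.log n) with hLdef
  have hn' : (1 : ℝ) ≤ n := by exact_mod_cast hn
  have hlog : Real.log n = L ^ 2 / 2 := by
    rw [hLdef, Real.sq_sqrt (by have := Real.log_nonneg hn'; positivity)]; ring
  refine le_trans ?_ (gaussianPDFReal_le_measureReal_Ici (x := a * L) (by positivity))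
  have hpi : 0 < √(2 * Real.pi) := by positivity
  have hpdf : gaussianPDFReal 0 1 (a * L + 1) =
      Real.exp (-Real.log (√(2 * Real.pi)) - (a * L + 1) ^ 2 / 2) := by
    rw [sub_eq_add_neg, Real.exp_add, Real.exp_neg, Real.exp_log hpi]
    simp [gaussianPDFReal, neg_div]
  rw [hpdf, Real.rpow_def_of_pos (by positivity), hlog]
  apply Real.exp_le_exp.2
  rw [div_le_iff₀ hε] at h1 h2
  have h4 : a * L ≤ ε * L ^ 2 / 4 := by nlinarith
  have h5 : C ≤ ε * L ^ 2 / 4 := by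
    have := le_abs_self C
    nlinarith [mul_pos hε (by linarith : 0 < L)]
  nlinarith

/-! ### Asymptotics -/

open Filter Topology

/-- Letting `n → ∞` and then `δ → 0` in the non-asymptotic bound. -/
lemma one_le_add_of_tendsto {H : ∀ n : ℕ, Finset (Fin n)} {μ t α β p q : ℕ → ℝ} {α₀ β₀ : ℝ}
    (hach : ∀ n : ℕ, 1 ≤ n → Achievable (gaussianLocation (H n) (μ n)) (H n) (α n) (β n))
    (hp : ∀ n, p n = (gaussianReal 0 1).real (Set.Ici (t n)))
    (hq : ∀ n, q n = (gaussianReal 0 1).real (Set.Iic (t n - μ n)))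
    (hN : Tendsto (fun n => ((H n)ᶜ.card : ℝ) * p n) atTop atTop)
    (hS : Tendsto (fun n => ((H n).card : ℝ) * q n) atTop atTop)
    (hα : Tendsto α atTop (𝓝 α₀))
    (hαN : Tendsto (fun n => α n * (H n).card / ((H n)ᶜ.card * p n)) atTop (𝓝 0))
    (hβ : Tendsto (fun n => β n / q n) atTop (𝓝 β₀)) : 1 ≤ α₀ + β₀ := by
  have key : ∀ δ : ℝ, 0 < δ → δ < 1 → 1 ≤ α₀ + β₀ / (1 - δ) := by
    intro δ hδ hδ1
    have hlim : Tendsto (fun n => α n + α n * (H n).card / ((H n)ᶜ.card * p n) / (1 - δ) +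
        β n / q n / (1 - δ) + (δ ^ 2)⁻¹ * ((H n)ᶜ.card * p n)⁻¹ +
        (δ ^ 2)⁻¹ * ((H n).card * q n)⁻¹) atTop
        (𝓝 (α₀ + 0 / (1 - δ) + β₀ / (1 - δ) + (δ ^ 2)⁻¹ * 0 + (δ ^ 2)⁻¹ * 0)) :=
      (((hα.add (hαN.div_const _)).add (hβ.div_const _)).add
        (hN.inv_tendsto_atTop.const_mul _)).add (hS.inv_tendsto_atTop.const_mul _)
    simp only [zero_div, mul_zero, add_zero] at hlim
    refine ge_of_tendsto hlim ?_
    filter_upwards [hN.eventually_gt_atTop 0, hS.eventually_gt_atTop 0, eventually_ge_atTop 1]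
      with n h0 h1 hn
    refine (one_le_of_achievable (hach n hn) (t n) hδ hδ1 (hp n) (hq n) h0 h1).trans (le_of_eq ?_)
    have hδ' : 1 - δ ≠ 0 := by linarith
    have hq0 : q n ≠ 0 := right_ne_zero_of_mul h1.ne'
    have hp0 : p n ≠ 0 := right_ne_zero_of_mul h0.ne'
    have hm0 : ((H n).card : ℝ) ≠ 0 := left_ne_zero_of_mul h1.ne'
    have hc0 : (((H n)ᶜ.card : ℕ) : ℝ) ≠ 0 := left_ne_zero_of_mul h0.ne'
    field_simp
  have hlim : Tendsto (fun δ : ℝ => α₀ + β₀ / (1 - δ)) (𝓝[>] 0) (𝓝 (α₀ + β₀)) := by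
    have : ContinuousAt (fun δ : ℝ => α₀ + β₀ / (1 - δ)) 0 := by
      refine continuousAt_const.add (continuousAt_const.div (by fun_prop) (by norm_num))
    simpa using this.tendsto.mono_left nhdsWithin_le_nhds
  refine ge_of_tendsto hlim ?_
  filter_upwards [Ioo_mem_nhdsGT (zero_lt_one' ℝ)] with δ hδ
  exact key δ hδ.1 hδ.2

lemma tendsto_natCast_rpow_atTop {y : ℝ} (hy : 0 < y) :
    Tendsto (fun n : ℕ => (n : ℝ) ^ y) atTop atTop :=
  (tendsto_rpow_atTop hy).comp tendsto_natCast_atTop_atTop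

lemma tendsto_natCast_rpow_neg {y : ℝ} (hy : 0 < y) :
    Tendsto (fun n : ℕ => (n : ℝ) ^ (-y)) atTop (𝓝 0) :=
  (tendsto_rpow_neg_atTop hy).comp tendsto_natCast_atTop_atTop

/-- A level `c n ^ (-κ)` that is eventually below `1` either tends to `0` or is the
constant `c < 1`. -/
lemma level_cases {c κ : ℝ} (hc : 0 < c) (h : ∀ᶠ n : ℕ in atTop, c * (n : ℝ) ^ (-κ) < 1) :
    (0 < κ ∧ Tendsto (fun n : ℕ => c * (n : ℝ) ^ (-κ)) atTop (𝓝 0)) ∨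
    (κ = 0 ∧ c < 1 ∧ Tendsto (fun n : ℕ => c * (n : ℝ) ^ (-κ)) atTop (𝓝 c)) := by
  rcases lt_trichotomy κ 0 with hκ | hκ | hκ
  · obtain ⟨n, h1, h2⟩ := (h.and (((tendsto_natCast_rpow_atTop (neg_pos.2 hκ)).const_mul_atTop
      hc).eventually_ge_atTop 1)).exists
    linarith
  · subst hκ
    obtain ⟨n, hn⟩ := h.exists
    exact Or.inr ⟨rfl, by simpa using hn, by simp⟩
  · exact Or.inl ⟨hκ, by simpa only [mul_zero] using (tendsto_natCast_rpow_neg hκ).const_mul c⟩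

section Counts

variable {s : ℝ} {H : ∀ n : ℕ, Finset (Fin n)}

lemma card_le_two_mul_rpow (hs1 : s < 1)
    (hH : ∀ n : ℕ, 1 ≤ n → |((H n).card : ℝ) - (n : ℝ) ^ (1 - s)| < 1) {n : ℕ} (hn : 1 ≤ n) :
    ((H n).card : ℝ) ≤ 2 * (n : ℝ) ^ (1 - s) := by
  have h1 := (abs_lt.1 (hH n hn)).2
  have h2 : 1 ≤ (n : ℝ) ^ (1 - s) :=
    Real.one_le_rpow (by exact_mod_cast hn) (by linarith)
  linarith

lemma eventually_le_card (hs1 : s < 1)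
    (hH : ∀ n : ℕ, 1 ≤ n → |((H n).card : ℝ) - (n : ℝ) ^ (1 - s)| < 1) :
    ∀ᶠ n : ℕ in atTop, 1 / 2 * (n : ℝ) ^ (1 - s) ≤ ((H n).card : ℝ) := by
  filter_upwards [(tendsto_natCast_rpow_atTop (sub_pos.2 hs1)).eventually_ge_atTop 2,
    eventually_ge_atTop 1] with n h2 hn
  have h1 := (abs_lt.1 (hH n hn)).1
  linarith

lemma eventually_le_card_compl (hs : 0 < s) (hs1 : s < 1)
    (hH : ∀ n : ℕ, 1 ≤ n → |((H n).card : ℝ) - (n : ℝ) ^ (1 - s)| < 1) :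
    ∀ᶠ n : ℕ in atTop, 1 / 2 * (n : ℝ) ≤ ((H n)ᶜ.card : ℝ) := by
  filter_upwards [(tendsto_natCast_rpow_neg hs).eventually_le_const (by norm_num : (0 : ℝ) < 1 / 4),
    eventually_ge_atTop 1] with n h2 hn
  have h1 := card_le_two_mul_rpow hs1 hH hn
  have hn0 : (0 : ℝ) < n := by exact_mod_cast hn
  have h3 : (n : ℝ) ^ (1 - s) ≤ n * (1 / 4) := by
    rw [sub_eq_add_neg, Real.rpow_add hn0, Real.rpow_one]
    exact mul_le_mul_of_nonneg_left h2 hn0.le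
  have h4 : (((H n)ᶜ.card : ℕ) : ℝ) = n - (H n).card := by
    rw [Finset.card_compl, Fintype.card_fin, Nat.cast_sub (by simpa using (H n).card_le_univ)]
  rw [h4]
  linarith

variable {a : ℝ} {p : ℕ → ℝ}

lemma eventually_le_card_compl_mul (hs : 0 < s) (hs1 : s < 1)
    (hH : ∀ n : ℕ, 1 ≤ n → |((H n).card : ℝ) - (n : ℝ) ^ (1 - s)| < 1) (ha : 0 ≤ a)
    (hp : ∀ n : ℕ, p n = (gaussianReal 0 1).real (Set.Ici (a * √(2 * Real.log n))))
    {ε : ℝ} (hε : 0 < ε) :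
    ∀ᶠ n : ℕ in atTop, 1 / 2 * (n : ℝ) ^ (1 - (a ^ 2 + ε)) ≤ ((H n)ᶜ.card : ℝ) * p n := by
  filter_upwards [eventually_le_card_compl hs hs1 hH, eventually_rpow_le_tail ha hε,
    eventually_ge_atTop 1] with n h1 h2 hn
  have hn0 : (0 : ℝ) < n := by exact_mod_cast hn
  rw [sub_eq_add_neg, Real.rpow_add hn0, Real.rpow_one, ← mul_assoc, hp n]
  exact mul_le_mul h1 h2 (by positivity) (by positivity)

/-- Below the level `√(2 log n)` the expected number of false rejections diverges. -/
lemma tendsto_card_compl_mul (hs : 0 < s) (hs1 : s < 1)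
    (hH : ∀ n : ℕ, 1 ≤ n → |((H n).card : ℝ) - (n : ℝ) ^ (1 - s)| < 1) (ha : 0 ≤ a) (ha1 : a < 1)
    (hp : ∀ n : ℕ, p n = (gaussianReal 0 1).real (Set.Ici (a * √(2 * Real.log n)))) :
    Tendsto (fun n => ((H n)ᶜ.card : ℝ) * p n) atTop atTop := by
  have h1 : a ^ 2 < 1 := by nlinarith
  exact tendsto_atTop_mono' _ (eventually_le_card_compl_mul hs hs1 hH ha hp
    (ε := (1 - a ^ 2) / 2) (by linarith))
    ((tendsto_natCast_rpow_atTop (by linarith)).const_mul_atTop (by norm_num))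

/-- If `a² < s + κ`, the nulls above the threshold are too many for the level `c n ^ (-κ)`. -/
lemma tendsto_level_mul_card_div (hs : 0 < s) (hs1 : s < 1)
    (hH : ∀ n : ℕ, 1 ≤ n → |((H n).card : ℝ) - (n : ℝ) ^ (1 - s)| < 1) (ha : 0 ≤ a)
    (hp : ∀ n : ℕ, p n = (gaussianReal 0 1).real (Set.Ici (a * √(2 * Real.log n))))
    {c κ : ℝ} (hc : 0 < c) (hκ : a ^ 2 < s + κ) :
    Tendsto (fun n : ℕ => c * (n : ℝ) ^ (-κ) * (H n).card / ((H n)ᶜ.card * p n)) atTop (𝓝 0) := by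
  set ε := (s + κ - a ^ 2) / 2 with hε
  have hε0 : 0 < ε := by rw [hε]; linarith
  have hlim : Tendsto (fun n : ℕ => 4 * c * (n : ℝ) ^ (-ε)) atTop (𝓝 0) := by
    simpa only [mul_zero] using (tendsto_natCast_rpow_neg hε0).const_mul (4 * c)
  have hp0 : ∀ n, 0 ≤ p n := fun n => by rw [hp n]; exact measureReal_nonneg
  refine tendsto_of_tendsto_of_tendsto_of_le_of_le' tendsto_const_nhds hlim
    (Eventually.of_forall fun n => by have := hp0 n; positivity) ?_
  filter_upwards [eventually_le_card_compl_mul hs hs1 hH ha hp hε0, eventually_ge_atTop 1]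
    with n h1 hn
  have hn0 : (0 : ℝ) < n := by exact_mod_cast hn
  have hpos : 0 < 1 / 2 * (n : ℝ) ^ (1 - (a ^ 2 + ε)) := by positivity
  rw [div_le_iff₀ (hpos.trans_le h1)]
  calc c * (n : ℝ) ^ (-κ) * (H n).card
      ≤ c * (n : ℝ) ^ (-κ) * (2 * (n : ℝ) ^ (1 - s)) :=
        mul_le_mul_of_nonneg_left (card_le_two_mul_rpow hs1 hH hn) (by positivity)
    _ = 4 * c * (n : ℝ) ^ (-ε) * (1 / 2 * (n : ℝ) ^ (1 - (a ^ 2 + ε))) := by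
        have e1 : (n : ℝ) ^ (-κ) * (n : ℝ) ^ (1 - s) =
            (n : ℝ) ^ (-ε) * (n : ℝ) ^ (1 - (a ^ 2 + ε)) := by
          rw [← Real.rpow_add hn0, ← Real.rpow_add hn0]
          congr 1
          rw [hε]; ring
        linear_combination 2 * c * e1
    _ ≤ _ := mul_le_mul_of_nonneg_left h1 (by positivity)

/-- If `b² < 1 - s`, the expected number of signals below `μ - b √(2 log n)` diverges. -/
lemma tendsto_card_mul_tail (hs1 : s < 1)
    (hH : ∀ n : ℕ, 1 ≤ n → |((H n).card : ℝ) - (n : ℝ) ^ (1 - s)| < 1) {b : ℝ} (hb : 0 ≤ b)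
    (hb1 : b ^ 2 < 1 - s) :
    Tendsto (fun n : ℕ => ((H n).card : ℝ) *
      (gaussianReal 0 1).real (Set.Ici (b * √(2 * Real.log n)))) atTop atTop := by
  set ε := (1 - s - b ^ 2) / 2 with hε
  have hε0 : 0 < ε := by rw [hε]; linarith
  refine tendsto_atTop_mono' _ ?_
    ((tendsto_natCast_rpow_atTop hε0).const_mul_atTop (by norm_num : (0 : ℝ) < 1 / 2))
  filter_upwards [eventually_le_card hs1 hH, eventually_rpow_le_tail hb hε0,
    eventually_ge_atTop 1] with n h1 h2 hn
  have hn0 : (0 : ℝ) < n := by exact_mod_cast hn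
  have e : (n : ℝ) ^ ε = (n : ℝ) ^ (1 - s) * (n : ℝ) ^ (-(b ^ 2 + ε)) := by
    rw [← Real.rpow_add hn0]
    congr 1
    rw [hε]; ring
  rw [e, ← mul_assoc]
  exact mul_le_mul h1 h2 (by positivity) (by positivity)

/-- If `b² < κ`, missing the signals below `μ - b √(2 log n)` violates the level `c n ^ (-κ)`. -/
lemma tendsto_level_div_tail {b c κ : ℝ} (hb : 0 ≤ b) (hc : 0 < c) (hκ : b ^ 2 < κ) :
    Tendsto (fun n : ℕ => c * (n : ℝ) ^ (-κ) /
      (gaussianReal 0 1).real (Set.Ici (b * √(2 * Real.log n)))) atTop (𝓝 0) := by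
  set ε := (κ - b ^ 2) / 2 with hε
  have hε0 : 0 < ε := by rw [hε]; linarith
  have hlim : Tendsto (fun n : ℕ => c * (n : ℝ) ^ (-ε)) atTop (𝓝 0) := by
    simpa only [mul_zero] using (tendsto_natCast_rpow_neg hε0).const_mul c
  refine tendsto_of_tendsto_of_tendsto_of_le_of_le' tendsto_const_nhds hlim
    (Eventually.of_forall fun n => by positivity) ?_
  filter_upwards [eventually_rpow_le_tail hb hε0, eventually_ge_atTop 1] with n h2 hn
  have hn0 : (0 : ℝ) < n := by exact_mod_cast hn
  have hpos : 0 < (n : ℝ) ^ (-(b ^ 2 + ε)) := by positivity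
  rw [div_le_iff₀ (hpos.trans_le h2)]
  have e : -κ = -ε + -(b ^ 2 + ε) := by rw [hε]; ring
  rw [e, Real.rpow_add hn0, ← mul_assoc]
  exact mul_le_mul_of_nonneg_left h2 (by positivity)

end Counts

lemma tendsto_measureReal_Iic {b : ℝ} (hb : 0 < b) :
    Tendsto (fun n : ℕ => (gaussianReal 0 1).real (Set.Iic (b * √(2 * Real.log n))))
      atTop (𝓝 1) := by
  have hL : Tendsto (fun n : ℕ => b * √(2 * Real.log n)) atTop atTop :=
    (Real.tendsto_sqrt_atTop.comp ((Real.tendsto_log_atTop.comp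
      tendsto_natCast_atTop_atTop).const_mul_atTop two_pos)).const_mul_atTop hb
  simpa only [Function.comp_def, cdf_eq_real] using
    (tendsto_cdf_atTop (gaussianReal 0 1)).comp hL

/-- The boundary curve `√(s + κα) + √κβ = √r` of attainable exponents. -/
lemma sqrt_add_sqrt_le (s r κα κβ c : ℝ) (hs : 0 < s) (hsr : s < r) (hr : r < 1)
    (hc : 0 < c) (H : ∀ n : ℕ, Finset (Fin n))
    (hH : ∀ n : ℕ, 1 ≤ n → |((H n).card : ℝ) - (n : ℝ) ^ (1 - s)| < 1)
    (hlα : ∀ᶠ n : ℕ in atTop, c * (n : ℝ) ^ (-κα) < 1)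
    (hlβ : ∀ᶠ n : ℕ in atTop, c * (n : ℝ) ^ (-κβ) < 1)
    (hach : ∀ n : ℕ, 1 ≤ n → Achievable (gaussianLocation (H n) √(2 * r * Real.log n)) (H n)
      (c * (n : ℝ) ^ (-κα)) (c * (n : ℝ) ^ (-κβ))) :
    √(s + κα) + √κβ ≤ √r := by
  by_contra! hlt
  have hs1 : s < 1 := hsr.trans hr
  have hκα : 0 ≤ κα := by rcases level_cases hc hlα with h | h <;> linarith [h.1]
  have hr0 : 0 < √r := Real.sqrt_pos.2 (hs.trans hsr)
  have hr1 : √r < 1 := by rw [Real.sqrt_lt' one_pos]; linarith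
  have hsκ : √s ≤ √(s + κα) := Real.sqrt_le_sqrt (by linarith)
  have hs0 : 0 < √s := Real.sqrt_pos.2 hs
  have hμ : ∀ n : ℕ, √(2 * r * Real.log n) = √r * √(2 * Real.log n) := fun n => by
    rw [← Real.sqrt_mul (hs.trans hsr).le]; congr 1; ring
  rcases level_cases hc hlβ with ⟨hκβ, -⟩ | ⟨rfl, hc1, hβ⟩
  · -- The threshold lies strictly below the signal mean. The bound `a > √r - √(1 - s)`, which makes
    -- the number of missed signals diverge, is compatible with the rest because `r < 1`.
    have h1s : 1 ≤ √s + √(1 - s) := by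
      have e1 := Real.sq_sqrt hs.le
      have e2 := Real.sq_sqrt (sub_nonneg.2 hs1.le)
      have := Real.sqrt_nonneg (1 - s)
      nlinarith
    have h1s0 : 0 < √(1 - s) := Real.sqrt_pos.2 (by linarith)
    have hκβ0 : 0 < √κβ := Real.sqrt_pos.2 hκβ
    obtain ⟨a, hal, hau⟩ : ∃ a, max (max (√r - √κβ) (√r - √(1 - s))) 0 < a ∧
        a < min √r √(s + κα) := by
      refine exists_between (max_lt (max_lt (lt_min ?_ ?_) (lt_min ?_ ?_)) (lt_min ?_ ?_)) <;>
        linarith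
    simp only [max_lt_iff, lt_min_iff] at hal hau
    obtain ⟨⟨ha1, ha2⟩, ha0⟩ := hal
    have hb : 0 ≤ √r - a := by linarith
    have hq : ∀ n : ℕ, (gaussianReal 0 1).real (Set.Ici ((√r - a) * √(2 * Real.log n))) =
        (gaussianReal 0 1).real
          (Set.Iic (a * √(2 * Real.log n) - √(2 * r * Real.log n))) := fun n => by
      rw [← measureReal_Iic_neg, hμ]; congr 2; ring
    have hα0 : ∃ α₀ < 1, Tendsto (fun n : ℕ => c * (n : ℝ) ^ (-κα)) atTop (𝓝 α₀) := by
      rcases level_cases hc hlα with ⟨-, h⟩ | ⟨-, h1, h⟩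
      exacts [⟨0, one_pos, h⟩, ⟨c, h1, h⟩]
    obtain ⟨α₀, hα1, hα⟩ := hα0
    have := one_le_add_of_tendsto hach (fun _ => rfl) hq
      (tendsto_card_compl_mul hs hs1 hH ha0.le (by linarith) fun _ => rfl)
      (tendsto_card_mul_tail hs1 hH hb ((Real.lt_sqrt hb).1 (by linarith))) hα
      (tendsto_level_mul_card_div hs hs1 hH ha0.le (fun _ => rfl) hc
        ((Real.lt_sqrt ha0.le).1 hau.2))
      (tendsto_level_div_tail hb hc ((Real.lt_sqrt hb).1 (by linarith)))
    linarith
  · -- The threshold lies strictly above the signal mean, so that almost all signals are missed.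
    rw [Real.sqrt_zero, add_zero] at hlt
    have hκα0 : 0 < κα := by
      have := (Real.sqrt_lt_sqrt_iff (hs.trans hsr).le).1 hlt
      linarith
    have hα : Tendsto (fun n : ℕ => c * (n : ℝ) ^ (-κα)) atTop (𝓝 0) := by
      rcases level_cases hc hlα with h | h
      exacts [h.2, absurd h.1 hκα0.ne']
    obtain ⟨a, hal, hau⟩ := exists_between (lt_min hr1 hlt)
    rw [lt_min_iff] at hau
    have ha0 : 0 < a := hr0.trans hal
    have hq : ∀ n : ℕ, (gaussianReal 0 1).real (Set.Iic ((a - √r) * √(2 * Real.log n))) =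
        (gaussianReal 0 1).real
          (Set.Iic (a * √(2 * Real.log n) - √(2 * r * Real.log n))) := fun n => by
      rw [hμ]; congr 2; ring
    have hq1 := tendsto_measureReal_Iic (sub_pos.2 hal)
    have hm : Tendsto (fun n => ((H n).card : ℝ)) atTop atTop :=
      tendsto_atTop_mono' _ (eventually_le_card hs1 hH)
        ((tendsto_natCast_rpow_atTop (sub_pos.2 hs1)).const_mul_atTop (by norm_num))
    have := one_le_add_of_tendsto hach (fun _ => rfl) hq
      (tendsto_card_compl_mul hs hs1 hH ha0.le hau.1 fun _ => rfl)
      (hm.atTop_mul_pos one_pos hq1) hα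
      (tendsto_level_mul_card_div hs hs1 hH ha0.le (fun _ => rfl) hc
        ((Real.lt_sqrt ha0.le).1 hau.2))
      (hβ.div hq1 one_ne_zero)
    linarith

end MultipleTesting

theorem mainTheorem2 (s r κα κβ c : ℝ) (hs : 0 < s) (hsr : s < r) (hr : r < 1) (hc : 0 < c)
    (H : ∀ n : ℕ, Finset (Fin n))
    (hH : ∀ n : ℕ, 1 ≤ n → |((H n).card : ℝ) - (n : ℝ) ^ (1 - s)| < 1)
    (hlevel : ∀ᶠ n : ℕ in Filter.atTop,
      c * (n : ℝ) ^ (-κα) < 1 ∧ c * (n : ℝ) ^ (-κβ) < 1)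
    (hach : ∀ n : ℕ, 1 ≤ n →
      MultipleTesting.Achievable
        (MultipleTesting.gaussianLocation (H n) (Real.sqrt (2 * r * Real.log n))) (H n)
        (c * (n : ℝ) ^ (-κα)) (c * (n : ℝ) ^ (-κβ))) :
    Real.sqrt (s + κα) + Real.sqrt κβ ≤ Real.sqrt r ∧
      min κα κβ ≤ (r - s) ^ 2 / (4 * r) := by
  have h := MultipleTesting.sqrt_add_sqrt_le s r κα κβ c hs hsr hr hc H hH
    (hlevel.mono fun _ h => h.1) (hlevel.mono fun _ h => h.2) hach
  refine ⟨h, ?_⟩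
  have hr0 : 0 < r := hs.trans hsr
  by_contra! hmin
  rw [lt_min_iff] at hmin
  -- At `κα = κβ = (r - s)² / (4 r)` the boundary curve is met exactly:
  -- `s + κα = ((r + s) / (2 √r))²` and `κβ = ((r - s) / (2 √r))²`.
  have hsq : √r ^ 2 = r := Real.sq_sqrt hr0.le
  have hsr0 : 0 < √r := Real.sqrt_pos.2 hr0
  have h1 : (r + s) / (2 * √r) < √(s + κα) := by
    rw [Real.lt_sqrt (by positivity), div_pow, mul_pow, hsq]
    have : (r + s) ^ 2 / (2 ^ 2 * r) = s + (r - s) ^ 2 / (4 * r) := by field_simp; ring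
    linarith [hmin.1]
  have h2 : (r - s) / (2 * √r) < √κβ := by
    rw [Real.lt_sqrt (div_nonneg (by linarith) (by positivity)), div_pow, mul_pow, hsq]
    have : (r - s) ^ 2 / (2 ^ 2 * r) = (r - s) ^ 2 / (4 * r) := by norm_num
    linarith [hmin.2]
  have h3 : (r + s) / (2 * √r) + (r - s) / (2 * √r) = √r := by
    field_simp
    rw [hsq]; ring
  linarith
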